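/- All languages are relational and all structures are nonempty. Let $(\mathcal A_i)_{i\in I}$ be a nonempty family of structures of a common language $\Sigma_0$ (their universes $A_i$ may overlap), and let $P_i$ $(i\in I)$ be distinct unary predicate symbols not in $\Sigma_0$. Put $\Sigma=\Sigma_0\cup\{P_i\mid i\in I\}$. The $P$-union $\mathcal A_P$ is the $\Sigma$-structure with universe $\bigcup_{i\in I}A_i$ in which each $P_i$ is interpreted by $A_i$, and each relation symbol of $\Sigma_0$ is interpreted by the union over $i\in I$ of its interpretations in the structures $\mathcal A_i$. It is called the $P$-combination of the $\mathcal A_i$ if, for every $i\in I$, the restriction of $\mathcal A_P$ to $A_i$, reduced to $\Sigma_0$, equals $\mathcal A_i$. For $T=\mathrm{Th}(\mathcal A_P)$ let $p_\infty(x)=\{\neg P_i(x)\mid i\in I\}$. The $e$-spectrum $e\text{-}\mathrm{Sp}(T)$ is the number of pairwise elementarily non-equivalent nonempty restrictions of models $\mathcal M\models T$ to the set of realizations of $p_\infty(x)$ in $\mathcal M$, i.e. the cardinality of the set of complete theories of such restrictions. Proposition 4.12. For every cardinal $\lambda$ there is a $P$-combination $\mathcal A_P$ in a language $\Sigma$ with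 exactly $|\Sigma|=\max\{\lambda,\omega\}$ symbols such that the theory $T=\mathrm{Th}(\mathcal A_P)$ satisfies $e\text{-}\mathrm{Sp}(T)=\lambda$. -/

import Mathlib

universe u v w

/-- The unary predicate symbols `P_i`, one for each index `i : I`. -/
inductive PredSymbol (I : Type u) : ℕ → Type u
  | pred (i : I) : PredSymbol I 1

/-- The relational language whose symbols are exactly the unary predicates `P_i`, `i : I`. -/
def predLanguage (I : Type u) : FirstOrder.Language.{u, u} :=
  ⟨fun _ => PEmpty, PredSymbol I⟩

instance predLanguage_isRelational (I : Type u) : (predLanguage I).IsRelational :=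
  fun _ => inferInstanceAs (IsEmpty PEmpty.{u + 1})

/-- The language `Σ` of a `P`-combination: the common language `L₀` of the structures `𝒜_i`
together with new unary predicate symbols `P_i`, `i : I`. -/
abbrev combLanguage (L₀ : FirstOrder.Language.{u, u}) (I : Type u) : FirstOrder.Language.{u, u} :=
  L₀.sum (predLanguage I)

/-- The symbol `P_i` in the language of a `P`-combination. -/
def predSymbol (L₀ : FirstOrder.Language.{u, u}) {I : Type u} (i : I) :
    (combLanguage L₀ I).Relations 1 :=
  Sum.inr (PredSymbol.pred i)

/-- A family `(𝒜_i)_{i ∈ I}` of structures of the language `L₀`. The universe of `𝒜_i` is the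
nonempty set `P i`; the sets `P i` may overlap, and `A` is their union. -/
structure PFamily (L₀ : FirstOrder.Language.{u, u}) (I : Type u) (A : Type w) where
  /-- The universe of `𝒜_i`. -/
  P : I → Set A
  nonempty : ∀ i, (P i).Nonempty
  cover : ∀ a : A, ∃ i, a ∈ P i
  /-- The structure `𝒜_i`. -/
  str : ∀ i, L₀.Structure (P i)

namespace PFamily

variable {L₀ : FirstOrder.Language.{u, u}} {I : Type u} {A : Type w}

/-- The relation `r` of the structure `𝒜_i`. -/
def Rel (F : PFamily L₀ I A) (i : I) {n : ℕ} (r : L₀.Relations n) (x : Fin n → F.P i) : Prop :=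
  (F.str i).RelMap r x

/-- The union `⋃ 𝒜_i`: a relation holds of a tuple of `A` if and only if, for some `i`, the tuple
lies in the universe of `𝒜_i` and the relation holds of it there. -/
@[reducible] def unionStructure [L₀.IsRelational] (F : PFamily L₀ I A) : L₀.Structure A where
  RelMap r x := ∃ (i : I) (y : Fin _ → F.P i), (∀ k, (y k : A) = x k) ∧ F.Rel i r y

/-- The interpretation of the symbol `P_i` by the universe of `𝒜_i`. -/
@[reducible] def predStructure (F : PFamily L₀ I A) : (predLanguage I).Structure A where
  RelMap := fun r => match r with
    | PredSymbol.pred i => fun x => x 0 ∈ F.P i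

/-- The `P`-union `𝒜_P`: the union of the structures `𝒜_i`, expanded by the predicates `P_i`. -/
@[reducible] def combStructure [L₀.IsRelational] (F : PFamily L₀ I A) : (combLanguage L₀ I).Structure A :=
  @FirstOrder.Language.sumStructure L₀ (predLanguage I) A F.unionStructure F.predStructure

/-- The `P`-union `𝒜_P` is the `P`-combination of the structures `𝒜_i`: for each `i`, the structure
induced by `𝒜_P` on the universe of `𝒜_i`, reduced to the language of `𝒜_i`, is `𝒜_i`. -/
def IsPCombination [L₀.IsRelational] (F : PFamily L₀ I A) : Prop :=
  ∀ (i : I) (n : ℕ) (r : L₀.Relations n) (x : Fin n → F.P i),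
    F.unionStructure.RelMap r (fun k => (x k : A)) ↔ F.Rel i r x

/-- The theory `Th(𝒜_P)`. -/
def combTheory [L₀.IsRelational] (F : PFamily L₀ I A) : (combLanguage L₀ I).Theory :=
  @FirstOrder.Language.completeTheory (combLanguage L₀ I) A F.combStructure

end PFamily

/-- The restriction of a structure `M` to the set of realizations in `M` of the type
`p_∞(x) = {¬ P_i(x) | i ∈ I}`. It is a substructure, as the language is relational. -/
def pInfty (L₀ : FirstOrder.Language.{u, u}) [L₀.IsRelational] (I : Type u) (M : Type w)
    [(combLanguage L₀ I).Structure M] : (combLanguage L₀ I).Substructure M where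
  carrier := {a | ∀ i : I, ¬ FirstOrder.Language.Structure.RelMap (predSymbol L₀ i) ![a]}
  fun_mem := fun f => isEmptyElim f

/-- The `e`-spectrum of a theory `T`: the number of pairwise elementarily non-equivalent (nonempty)
restrictions of models of `T` to `p_∞(x)`, counted as the number of their complete theories.
By the downward Löwenheim–Skolem theorem, models in the universe of the language suffice. -/
noncomputable def eSp {L₀ : FirstOrder.Language.{u, u}} [L₀.IsRelational] {I : Type u}
    (T : (combLanguage L₀ I).Theory) : Cardinal.{u} :=
  Cardinal.mk {Θ : (combLanguage L₀ I).Theory |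
    ∃ M : FirstOrder.Language.Theory.ModelType.{u, u, u} T,
      Nonempty (pInfty L₀ I M) ∧ (combLanguage L₀ I).completeTheory (pInfty L₀ I M) = Θ}

open FirstOrder FirstOrder.Language

/-! Well-order a set `J` of size `lam` and use its elements as colors. A block with bound `a :
WithTop J` has infinitely many points of each color `j ≥ a`, and none if `a = ⊤`. The structures of
the family are blocks, countably many for each bound, all sharing one extra point `none`. This point
lies in every `P_i` and is the obligatory third argument of the relations `block` and `step`. Hence
no ternary relation survives on the realizations of `p_∞`, where only the colors remain.

The ternary relations still constrain `p_∞` in every model. Related points lie in the same `P_i`, so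
`block` makes the set of colors occurring in `p_∞` upward closed, and `step`, a strict order without
last elements there, makes every realized unary type infinite. Structures of this kind are
classified up to elementary equivalence by the unary types they realize
(`completeTheory_eq_of_unary`). These types are given by a final segment of `J` and by whether some
point has no color, which is possible only for infinite `J`. Therefore at most `lam` theories occur
(`eSp_le_mk`).

Conversely, an unlabelled block of bound `a : J` may be added without changing the theory: a
sentence mentions finitely many `P_i`, and the infinitely many blocks of bound `a` can be shifted to
absorb the new one. Its points are then exactly `p_∞`, with colors `Set.Ici a`
(`exists_model_inftyColors_eq`), which yields `lam` different theories (`mk_le_eSp`). -/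

/-! ### Elementary equivalence of structures with unary relations -/

/-- The set of unary relation symbols that hold at a point. -/
def unaryType (L : FirstOrder.Language.{u, v}) {M : Type w} [L.Structure M] (x : M) :
    Set (L.Relations 1) :=
  {r | Structure.RelMap r ![x]}

theorem exists_eq_var_of_isRelational {L : FirstOrder.Language.{u, v}} [L.IsRelational] {n : ℕ}
    (t : L.Term (Empty ⊕ Fin n)) : ∃ i, t = Term.var (Sum.inr i) := by
  cases t with
  | var a =>
    rcases a with a | i
    · exact a.elim
    · exact ⟨i, rfl⟩
  | func f _ => exact isEmptyElim f

/-- The extension step of a back-and-forth argument. A new point needs only a partner of the same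
type outside a finite tuple, and infinite types supply one. -/
theorem exists_extension_of_infinite_types {L : FirstOrder.Language.{u, v}} {M N : Type*} [L.Structure M]
    [L.Structure N] (hinf : ∀ x : M, {x' : M | unaryType L x' = unaryType L x}.Infinite)
    (hrange : Set.range (unaryType L (M := N)) ⊆ Set.range (unaryType L (M := M))) {n : ℕ}
    {x : Fin n → M} {y : Fin n → N} (hxy : ∀ i j, x i = x j ↔ y i = y j)
    (hty : ∀ i, unaryType L (x i) = unaryType L (y i)) (b : N) :
    ∃ a : M, unaryType L a = unaryType L b ∧ ∀ i, a = x i ↔ b = y i := by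
  by_cases hb : ∃ i, b = y i
  · obtain ⟨i, rfl⟩ := hb
    exact ⟨x i, hty i, fun j => hxy i j⟩
  · obtain ⟨a₀, ha₀⟩ := hrange ⟨b, rfl⟩
    obtain ⟨a, ha, hax⟩ := (hinf a₀).exists_notMem_finite (Set.finite_range x)
    push Not at hb
    refine ⟨a, ha.trans ha₀, fun i => iff_of_false ?_ (hb i)⟩
    rintro rfl
    exact hax ⟨i, rfl⟩

theorem forall_snoc_eq_iff {M N : Type*} {n : ℕ} {x : Fin n → M} {y : Fin n → N} {a : M} {b : N}
    (hxy : ∀ i j, x i = x j ↔ y i = y j) (hab : ∀ i, a = x i ↔ b = y i) (i j : Fin (n + 1)) :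
    (Fin.snoc x a : Fin (n + 1) → M) i = (Fin.snoc x a : Fin (n + 1) → M) j ↔
      (Fin.snoc y b : Fin (n + 1) → N) i = (Fin.snoc y b : Fin (n + 1) → N) j := by
  refine Fin.lastCases ?_ (fun i => ?_) i <;> refine Fin.lastCases ?_ (fun j => ?_) j
  · simp
  · simpa using hab j
  · simpa [eq_comm] using hab i
  · simpa using hxy i j

/-- Tuples with the same equality pattern and the same unary types cannot be distinguished; the
quantifier case is the back-and-forth extension in both directions. -/
theorem realize_iff_of_unary {L : FirstOrder.Language.{u, v}} [L.IsRelational] {M N : Type*} [L.Structure M]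
    [L.Structure N]
    (hM : ∀ n (r : L.Relations n) (x : Fin n → M), n ≠ 1 → ¬ Structure.RelMap r x)
    (hN : ∀ n (r : L.Relations n) (x : Fin n → N), n ≠ 1 → ¬ Structure.RelMap r x)
    (hMinf : ∀ x : M, {x' : M | unaryType L x' = unaryType L x}.Infinite)
    (hNinf : ∀ x : N, {x' : N | unaryType L x' = unaryType L x}.Infinite)
    (hrange : Set.range (unaryType L (M := M)) = Set.range (unaryType L (M := N))) {n : ℕ}
    (φ : L.BoundedFormula Empty n) (v : Empty → M) (v' : Empty → N) (x : Fin n → M)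
    (y : Fin n → N) (hxy : ∀ i j, x i = x j ↔ y i = y j)
    (hty : ∀ i, unaryType L (x i) = unaryType L (y i)) :
    φ.Realize v x ↔ φ.Realize v' y := by
  induction φ with
  | falsum => exact Iff.rfl
  | equal t₁ t₂ =>
    obtain ⟨i, rfl⟩ := exists_eq_var_of_isRelational t₁
    obtain ⟨j, rfl⟩ := exists_eq_var_of_isRelational t₂
    exact hxy i j
  | @rel n l r ts =>
    by_cases hl : l = 1
    · subst hl
      obtain ⟨i, hi⟩ := exists_eq_var_of_isRelational (ts 0)
      have h₁ : (fun k => (ts k).realize (Sum.elim v x)) = ![x i] := by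
        funext k
        rw [Subsingleton.elim k 0, hi]
        rfl
      have h₂ : (fun k => (ts k).realize (Sum.elim v' y)) = ![y i] := by
        funext k
        rw [Subsingleton.elim k 0, hi]
        rfl
      rw [BoundedFormula.Realize, BoundedFormula.Realize, h₁, h₂]
      exact Set.ext_iff.1 (hty i) r
    · exact iff_of_false (hM _ _ _ hl) (hN _ _ _ hl)
  | imp _ _ ih₁ ih₂ => exact imp_congr (ih₁ x y hxy hty) (ih₂ x y hxy hty)
  | all φ ih =>
    have key : ∀ (a : M) (b : N), unaryType L a = unaryType L b → (∀ i, a = x i ↔ b = y i) →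
        (φ.Realize v (Fin.snoc x a) ↔ φ.Realize v' (Fin.snoc y b)) := fun a b hab h =>
      ih _ _ (forall_snoc_eq_iff hxy h) fun i => by
        refine Fin.lastCases ?_ (fun i => ?_) i
        · simpa using hab
        · simpa using hty i
    rw [BoundedFormula.realize_all, BoundedFormula.realize_all]
    constructor
    · intro h b
      obtain ⟨a, hab, ha⟩ := exists_extension_of_infinite_types hMinf hrange.ge hxy hty b
      exact (key a b hab ha).1 (h a)
    · intro h a
      obtain ⟨b, hab, hb⟩ := exists_extension_of_infinite_types hNinf hrange.le
        (fun i j => (hxy i j).symm) (fun i => (hty i).symm) a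
      exact (key a b hab.symm fun i => (hb i).symm).2 (h b)

/-- Two structures without relations of arity other than one, in which the realized unary types
are the same and have infinitely many realizations, are elementarily equivalent. -/
theorem completeTheory_eq_of_unary {L : FirstOrder.Language.{u, v}} [L.IsRelational] {M N : Type*}
    [L.Structure M] [L.Structure N]
    (hM : ∀ n (r : L.Relations n) (x : Fin n → M), n ≠ 1 → ¬ Structure.RelMap r x)
    (hN : ∀ n (r : L.Relations n) (x : Fin n → N), n ≠ 1 → ¬ Structure.RelMap r x)
    (hMinf : ∀ x : M, {x' : M | unaryType L x' = unaryType L x}.Infinite)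
    (hNinf : ∀ x : N, {x' : N | unaryType L x' = unaryType L x}.Infinite)
    (hrange : Set.range (unaryType L (M := M)) = Set.range (unaryType L (M := N))) :
    L.completeTheory M = L.completeTheory N :=
  Set.ext fun φ => realize_iff_of_unary hM hN hMinf hNinf hrange φ _ _ _ _
    (fun i => i.elim0) (fun i => i.elim0)

/-! ### Elementary equivalence tested on finitely many predicates -/

/-- A formula mentions only finitely many of the predicates `P_i`. -/
theorem exists_finset_realize_iff {L₀ : FirstOrder.Language.{u, u}} [L₀.IsRelational] {I : Type u}
    {M N : Type*} [(combLanguage L₀ I).Structure M] [(combLanguage L₀ I).Structure N] {n : ℕ}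
    (φ : (combLanguage L₀ I).BoundedFormula Empty n) :
    ∃ s : Finset I, ∀ e : M ≃ N,
      (∀ (l : ℕ) (r : L₀.Relations l) (x : Fin l → M),
        Structure.RelMap (L := combLanguage L₀ I) (Sum.inl r) x ↔
          Structure.RelMap (L := combLanguage L₀ I) (Sum.inl r) (e ∘ x)) →
      (∀ i ∈ s, ∀ x : Fin 1 → M, Structure.RelMap (predSymbol L₀ i) x ↔
        Structure.RelMap (predSymbol L₀ i) (e ∘ x)) →
      ∀ (v : Empty → M) (v' : Empty → N) (x : Fin n → M),
        φ.Realize v x ↔ φ.Realize v' (e ∘ x) := by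
  classical
  induction φ with
  | falsum => exact ⟨∅, fun _ _ _ _ _ _ => Iff.rfl⟩
  | equal t₁ t₂ =>
    obtain ⟨i, rfl⟩ := exists_eq_var_of_isRelational t₁
    obtain ⟨j, rfl⟩ := exists_eq_var_of_isRelational t₂
    exact ⟨∅, fun e _ _ _ _ x => e.apply_eq_iff_eq.symm⟩
  | @rel n l r ts =>
    have hts : ∀ (e : M ≃ N) (v : Empty → M) (v' : Empty → N) (x : Fin n → M),
        (fun k => (ts k).realize (Sum.elim v' (e ∘ x))) =
          e ∘ fun k => (ts k).realize (Sum.elim v x) := by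
      intro e v v' x
      funext k
      obtain ⟨i, hi⟩ := exists_eq_var_of_isRelational (ts k)
      simp [hi]
    rcases r with r | ⟨⟨i⟩⟩
    · refine ⟨∅, fun e h _ v v' x => ?_⟩
      change Structure.RelMap _ _ ↔ Structure.RelMap _ _
      rw [hts e v v' x]
      exact h _ r _
    · refine ⟨{i}, fun e _ h v v' x => ?_⟩
      change Structure.RelMap _ _ ↔ Structure.RelMap _ _
      rw [hts e v v' x]
      exact h i (Finset.mem_singleton_self i) _
  | imp _ _ ih₁ ih₂ =>
    obtain ⟨s, hs⟩ := ih₁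
    obtain ⟨t, ht⟩ := ih₂
    exact ⟨s ∪ t, fun e h h' v v' x => imp_congr
      (hs e h (fun i hi => h' i (Finset.mem_union_left _ hi)) v v' x)
      (ht e h (fun i hi => h' i (Finset.mem_union_right _ hi)) v v' x)⟩
  | all φ ih =>
    obtain ⟨s, hs⟩ := ih
    refine ⟨s, fun e h h' v v' x => ?_⟩
    rw [BoundedFormula.realize_all, BoundedFormula.realize_all, ← e.forall_congr_right]
    refine forall_congr' fun a => ?_
    rw [hs e h h' v v', Fin.comp_snoc]

/-- The bijection may vary with the sentence, so the two structures need not be isomorphic in the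
full language. -/
theorem realize_completeTheory_of_equiv {L₀ : FirstOrder.Language.{u, u}} [L₀.IsRelational] {I : Type u}
    {M N : Type*} [(combLanguage L₀ I).Structure M] [(combLanguage L₀ I).Structure N]
    (h : ∀ s : Finset I, ∃ e : M ≃ N,
      (∀ (l : ℕ) (r : L₀.Relations l) (x : Fin l → M),
        Structure.RelMap (L := combLanguage L₀ I) (Sum.inl r) x ↔
          Structure.RelMap (L := combLanguage L₀ I) (Sum.inl r) (e ∘ x)) ∧
      ∀ i ∈ s, ∀ x : Fin 1 → M, Structure.RelMap (predSymbol L₀ i) x ↔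
        Structure.RelMap (predSymbol L₀ i) (e ∘ x)) :
    N ⊨ (combLanguage L₀ I).completeTheory M := by
  refine ⟨fun φ hφ => ?_⟩
  obtain ⟨s, hs⟩ := exists_finset_realize_iff (M := M) (N := N) φ
  obtain ⟨e, he, he'⟩ := h s
  have := (hs e he he' default default default).1 hφ
  rwa [Subsingleton.elim (e ∘ default) default] at this

/-! ### The color language and its axioms -/

/-- Symbols for colors `j : J` and two ternary relations. -/
inductive ColorSymbol (J : Type u) : ℕ → Type u
  | color (j : J) : ColorSymbol J 1
  | block : ColorSymbol J 3
  | step : ColorSymbol J 3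

/-- The relational language with a unary symbol for each color and two ternary symbols. -/
def colorLanguage (J : Type u) : FirstOrder.Language.{u, u} :=
  ⟨fun _ => PEmpty, ColorSymbol J⟩

instance colorLanguage_isRelational (J : Type u) : (colorLanguage J).IsRelational :=
  fun _ => inferInstanceAs (IsEmpty PEmpty.{u + 1})

section Symbols

variable {J I : Type u}

/-- The color `j` as a symbol of the language of a `P`-combination. -/
def colorSymbol (j : J) : (combLanguage (colorLanguage J) I).Relations 1 :=
  Sum.inl (ColorSymbol.color j)

/-- The symbol `block` in the language of a `P`-combination. -/
def blockSymbol : (combLanguage (colorLanguage J) I).Relations 3 :=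
  Sum.inl ColorSymbol.block

/-- The symbol `step` in the language of a `P`-combination. -/
def stepSymbol : (combLanguage (colorLanguage J) I).Relations 3 :=
  Sum.inl ColorSymbol.step

end Symbols

section Axioms

variable (J I : Type u) [LE J] (M : Type w) [(combLanguage (colorLanguage J) I).Structure M]

/-- First-order properties that control the realizations of `p_∞`. -/
structure ColorAxioms : Prop where
  block_pred : ∀ (i : I) (x y z : M), Structure.RelMap (blockSymbol (J := J) (I := I)) ![x, y, z] →
    Structure.RelMap (predSymbol (colorLanguage J) i) ![z] ∧
      (Structure.RelMap (predSymbol (colorLanguage J) i) ![x] ↔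
        Structure.RelMap (predSymbol (colorLanguage J) i) ![y])
  step_pred : ∀ (i : I) (x y z : M), Structure.RelMap (stepSymbol (J := J) (I := I)) ![x, y, z] →
    Structure.RelMap (predSymbol (colorLanguage J) i) ![z] ∧
      (Structure.RelMap (predSymbol (colorLanguage J) i) ![x] ↔
        Structure.RelMap (predSymbol (colorLanguage J) i) ![y])
  step_trans : ∀ x y z t t' : M, Structure.RelMap (stepSymbol (J := J) (I := I)) ![x, y, t] →
    Structure.RelMap (stepSymbol (J := J) (I := I)) ![y, z, t'] →
      Structure.RelMap (stepSymbol (J := J) (I := I)) ![x, z, t]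
  step_irrefl : ∀ x t : M, ¬ Structure.RelMap (stepSymbol (J := J) (I := I)) ![x, x, t]
  exists_block : ∀ a b : J, a ≤ b → ∀ x : M, Structure.RelMap (colorSymbol (I := I) a) ![x] →
    ∃ y t, Structure.RelMap (blockSymbol (J := J) (I := I)) ![x, y, t] ∧
      Structure.RelMap (colorSymbol (I := I) b) ![y]
  exists_step : ∀ (i : I) (x : M), ¬ Structure.RelMap (predSymbol (colorLanguage J) i) ![x] →
    ∃ y t, Structure.RelMap (stepSymbol (J := J) (I := I)) ![x, y, t]
  step_color : ∀ (j : J) (x y t : M),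
    Structure.RelMap (stepSymbol (J := J) (I := I)) ![x, y, t] →
      (Structure.RelMap (colorSymbol (I := I) j) ![x] ↔
        Structure.RelMap (colorSymbol (I := I) j) ![y])
  color_unique : ∀ a b : J, a ≠ b → ∀ x : M, Structure.RelMap (colorSymbol (I := I) a) ![x] →
    ¬ Structure.RelMap (colorSymbol (I := I) b) ![x]
  exists_color : Finite J → ∀ (i : I) (x : M),
    ¬ Structure.RelMap (predSymbol (colorLanguage J) i) ![x] →
      ∃ j : J, Structure.RelMap (colorSymbol (I := I) j) ![x]

end Axioms

theorem realize_boundedFormula_three {L : FirstOrder.Language.{u, v}} {M : Type w} [L.Structure M]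
    {α : Type*} {n : ℕ} (r : L.Relations 3) (t₁ t₂ t₃ : L.Term (α ⊕ Fin n)) (v : α → M)
    (x : Fin n → M) : (r.boundedFormula ![t₁, t₂, t₃]).Realize v x ↔
      Structure.RelMap r ![t₁.realize (Sum.elim v x), t₂.realize (Sum.elim v x),
        t₃.realize (Sum.elim v x)] := by
  rw [BoundedFormula.realize_rel, iff_iff_eq]
  congr 1
  funext k
  fin_cases k <;> rfl

theorem realize_of_models_completeTheory {L : FirstOrder.Language.{u, v}} {M N : Type*}
    [L.Structure M] [L.Structure N] (h : N ⊨ L.completeTheory M) (φ : L.Sentence)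
    {p q : Prop} (hp : M ⊨ φ ↔ p) (hq : N ⊨ φ ↔ q) (hM : p) : q :=
  hq.1 (h.realize_of_mem φ (hp.2 hM))

open BoundedFormula in
-- For fixed indices and colors each axiom is a single first-order sentence.
theorem ColorAxioms.of_models {J I : Type u} [LE J] {M N : Type*}
    [(combLanguage (colorLanguage J) I).Structure M]
    [(combLanguage (colorLanguage J) I).Structure N]
    (h : N ⊨ (combLanguage (colorLanguage J) I).completeTheory M) (hM : ColorAxioms J I M) :
    ColorAxioms J I N where
  block_pred i := by
    refine realize_of_models_completeTheory h
      (∀' ∀' ∀' (blockSymbol.boundedFormula ![&0, &1, &2] ⟹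
        ((predSymbol _ i).boundedFormula₁ (&2) ⊓
          ((predSymbol _ i).boundedFormula₁ (&0)).iff ((predSymbol _ i).boundedFormula₁ (&1)))))
      ?_ ?_ (hM.block_pred i) <;>
    simp [-realize_rel, Sentence.Realize, Formula.Realize, realize_boundedFormula_three, Fin.snoc]
  step_pred i := by
    refine realize_of_models_completeTheory h
      (∀' ∀' ∀' (stepSymbol.boundedFormula ![&0, &1, &2] ⟹
        ((predSymbol _ i).boundedFormula₁ (&2) ⊓
          ((predSymbol _ i).boundedFormula₁ (&0)).iff ((predSymbol _ i).boundedFormula₁ (&1)))))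
      ?_ ?_ (hM.step_pred i) <;>
    simp [-realize_rel, Sentence.Realize, Formula.Realize, realize_boundedFormula_three, Fin.snoc]
  step_trans := by
    refine realize_of_models_completeTheory h
      (∀' ∀' ∀' ∀' ∀' (stepSymbol.boundedFormula ![&0, &1, &3] ⟹
        stepSymbol.boundedFormula ![&1, &2, &4] ⟹ stepSymbol.boundedFormula ![&0, &2, &3]))
      ?_ ?_ hM.step_trans <;>
    simp [-realize_rel, Sentence.Realize, Formula.Realize, realize_boundedFormula_three, Fin.snoc]
  step_irrefl := by
    refine realize_of_models_completeTheory h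
      (∀' ∀' (∼ (stepSymbol.boundedFormula ![&0, &0, &1]))) ?_ ?_ hM.step_irrefl <;>
    simp [-realize_rel, Sentence.Realize, Formula.Realize, realize_boundedFormula_three, Fin.snoc]
  exists_block a b hab := by
    refine realize_of_models_completeTheory h
      (∀' ((colorSymbol a).boundedFormula₁ (&0) ⟹ ∃' ∃' (blockSymbol.boundedFormula ![&0, &1, &2] ⊓
        (colorSymbol b).boundedFormula₁ (&1)))) ?_ ?_ (hM.exists_block a b hab) <;>
    simp [-realize_rel, Sentence.Realize, Formula.Realize, realize_boundedFormula_three, Fin.snoc]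
  exists_step i := by
    refine realize_of_models_completeTheory h
      (∀' (∼ ((predSymbol _ i).boundedFormula₁ (&0)) ⟹
        ∃' ∃' (stepSymbol.boundedFormula ![&0, &1, &2]))) ?_ ?_ (hM.exists_step i) <;>
    simp [-realize_rel, Sentence.Realize, Formula.Realize, realize_boundedFormula_three, Fin.snoc]
  step_color j := by
    refine realize_of_models_completeTheory h
      (∀' ∀' ∀' (stepSymbol.boundedFormula ![&0, &1, &2] ⟹
        ((colorSymbol j).boundedFormula₁ (&0)).iff ((colorSymbol j).boundedFormula₁ (&1))))
      ?_ ?_ (hM.step_color j) <;>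
    simp [-realize_rel, Sentence.Realize, Formula.Realize, realize_boundedFormula_three, Fin.snoc]
  color_unique a b hab := by
    refine realize_of_models_completeTheory h
      (∀' ((colorSymbol a).boundedFormula₁ (&0) ⟹ ∼ ((colorSymbol b).boundedFormula₁ (&0))))
      ?_ ?_ (hM.color_unique a b hab) <;>
    simp [Sentence.Realize, Formula.Realize, Fin.snoc]
  -- Finiteness of `J` is what makes the disjunction over all colors a formula.
  exists_color hJ i := by
    refine realize_of_models_completeTheory h
      (∀' (∼ ((predSymbol _ i).boundedFormula₁ (&0)) ⟹
        BoundedFormula.iSup fun j : J => (colorSymbol j).boundedFormula₁ (&0)))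
      ?_ ?_ (hM.exists_color hJ i) <;>
    simp [Sentence.Realize, Formula.Realize, Fin.snoc]

/-! ### The restriction to the realizations of `p_∞` -/

section PInfty

variable {J I : Type u} {M : Type v} [(combLanguage (colorLanguage J) I).Structure M]

/-- The colors of the realizations of `p_∞`. -/
def inftyColors (J I : Type u) (M : Type v) [(combLanguage (colorLanguage J) I).Structure M] :
    Set J :=
  {j | ∃ x : pInfty (colorLanguage J) I M, Structure.RelMap (colorSymbol (I := I) j) ![x.1]}

/-- There is a realization of `p_∞` without color. -/
def HasColorless (J I : Type u) (M : Type v)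
    [(combLanguage (colorLanguage J) I).Structure M] : Prop :=
  ∃ x : pInfty (colorLanguage J) I M, ∀ j : J, ¬ Structure.RelMap (colorSymbol (I := I) j) ![x.1]

theorem relMap_pInfty_unary (r : (combLanguage (colorLanguage J) I).Relations 1)
    (x : pInfty (colorLanguage J) I M) :
    Structure.RelMap r ![x] ↔ Structure.RelMap r ![x.1] := by
  change Structure.RelMap r (fun k => ((![x] k : pInfty (colorLanguage J) I M) : M)) ↔ _
  rw [iff_iff_eq]
  congr 1
  funext k
  fin_cases k
  rfl

/-- All `P_i` fail on `p_∞`, so only the colors can distinguish types. -/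
theorem unaryType_pInfty_eq_iff {N : Type w} [(combLanguage (colorLanguage J) I).Structure N]
    (x : pInfty (colorLanguage J) I M) (y : pInfty (colorLanguage J) I N) :
    unaryType (combLanguage (colorLanguage J) I) x = unaryType _ y ↔
      ∀ j : J, Structure.RelMap (colorSymbol (I := I) j) ![x.1] ↔
        Structure.RelMap (colorSymbol (I := I) j) ![y.1] := by
  constructor
  · intro h j
    simpa only [unaryType, Set.mem_ofPred_eq, relMap_pInfty_unary] using
      Set.ext_iff.1 h (colorSymbol j)
  · intro h
    ext r
    simp only [unaryType, Set.mem_ofPred_eq, relMap_pInfty_unary]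
    rcases r with r | ⟨⟨i⟩⟩
    · cases r with
      | color j => exact h j
    · exact iff_of_false (x.2 i) (y.2 i)

/-- Shows that the theory of the restriction determines its set of colors, so that different sets
give different theories. -/
theorem mem_inftyColors_iff (j : J) : j ∈ inftyColors J I M ↔
    (∃' ((colorSymbol j).boundedFormula₁ (&0)) : (combLanguage (colorLanguage J) I).Sentence) ∈
      (combLanguage (colorLanguage J) I).completeTheory (pInfty (colorLanguage J) I M) := by
  simp [inftyColors, Sentence.Realize, Formula.Realize, Fin.snoc, relMap_pInfty_unary]

variable [LE J]

theorem ColorAxioms.inftyColors_upward (hM : ColorAxioms J I M) {a b : J} (hab : a ≤ b)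
    (ha : a ∈ inftyColors J I M) : b ∈ inftyColors J I M := by
  obtain ⟨x, hx⟩ := ha
  obtain ⟨y, t, hy, hby⟩ := hM.exists_block a b hab x hx
  exact ⟨⟨y, fun i hi => x.2 i ((hM.block_pred i _ _ _ hy).2.2 hi)⟩, hby⟩

/-- A point has at most one color, so its type on `p_∞` is fixed by that color or by having none. -/
theorem ColorAxioms.range_unaryType_subset {N : Type w}
    [(combLanguage (colorLanguage J) I).Structure N] (hM : ColorAxioms J I M)
    (hN : ColorAxioms J I N) (hc : inftyColors J I M ⊆ inftyColors J I N)
    (he : HasColorless J I M → HasColorless J I N) :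
    Set.range (unaryType (combLanguage (colorLanguage J) I)
        (M := pInfty (colorLanguage J) I M)) ⊆
      Set.range (unaryType _ (M := pInfty (colorLanguage J) I N)) := by
  rintro _ ⟨x, rfl⟩
  by_cases hx : ∃ j : J, Structure.RelMap (colorSymbol (I := I) j) ![x.1]
  · obtain ⟨j, hj⟩ := hx
    obtain ⟨y, hy⟩ := hc ⟨x, hj⟩
    refine ⟨y, (unaryType_pInfty_eq_iff y x).2 fun k => ?_⟩
    by_cases hk : j = k
    · subst hk
      exact iff_of_true hy hj
    · exact iff_of_false (hN.color_unique j k hk _ hy) (hM.color_unique j k hk _ hj)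
  · push Not at hx
    obtain ⟨y, hy⟩ := he ⟨x, hx⟩
    exact ⟨y, (unaryType_pInfty_eq_iff y x).2 fun k => iff_of_false (hy k) (hx k)⟩

variable [Nonempty I]

/-- The third argument of `block` and `step` lies in every `P_i`, hence, as `I` is nonempty, outside
`p_∞`. -/
theorem ColorAxioms.not_relMap_pInfty (hM : ColorAxioms J I M) (n : ℕ)
    (r : (combLanguage (colorLanguage J) I).Relations n)
    (x : Fin n → pInfty (colorLanguage J) I M) (hn : n ≠ 1) : ¬ Structure.RelMap r x := by
  intro h
  replace h : Structure.RelMap r (fun k => (x k : M)) := h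
  inhabit I
  rcases r with r | ⟨⟨i⟩⟩
  · cases r with
    | color j => exact hn rfl
    | block =>
      have hx : ![(x 0 : M), x 1, x 2] = fun k => (x k : M) := by
        funext k
        fin_cases k <;> rfl
      exact (x 2).2 default (hM.block_pred default (x 0) (x 1) (x 2) (by rw [hx]; exact h)).1
    | step =>
      have hx : ![(x 0 : M), x 1, x 2] = fun k => (x k : M) := by
        funext k
        fin_cases k <;> rfl
      exact (x 2).2 default (hM.step_pred default (x 0) (x 1) (x 2) (by rw [hx]; exact h)).1
  · exact hn rfl

/-- On `p_∞` every point has a `step`-successor, again in `p_∞` and of the same type, so a finite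
type would contain a `step`-maximal point, which is impossible. -/
theorem ColorAxioms.infinite_unaryType (hM : ColorAxioms J I M)
    (x : pInfty (colorLanguage J) I M) :
    {x' : pInfty (colorLanguage J) I M |
      unaryType (combLanguage (colorLanguage J) I) x' = unaryType _ x}.Infinite := by
  inhabit I
  rw [← Set.infinite_coe_iff]
  refine not_finite_iff_infinite.1 fun hfin => ?_
  let S := {x' : pInfty (colorLanguage J) I M |
      unaryType (combLanguage (colorLanguage J) I) x' = unaryType _ x}
  -- The order is reversed: an `R`-minimal element is one without `step`-successor in `S`.
  let R : S → S → Prop := fun a b =>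
    ∃ t : M, Structure.RelMap (stepSymbol (J := J) (I := I)) ![b.1.1, a.1.1, t]
  have : IsTrans S R := ⟨fun a b c ⟨t, ht⟩ ⟨t', ht'⟩ => ⟨t', hM.step_trans _ _ _ _ _ ht' ht⟩⟩
  have : Std.Irrefl R := ⟨fun a ⟨t, ht⟩ => hM.step_irrefl _ _ ht⟩
  obtain ⟨a, -, ha⟩ := (Finite.wellFounded_of_trans_of_irrefl R).has_min Set.univ ⟨⟨x, rfl⟩, trivial⟩
  obtain ⟨y, t, hy⟩ := hM.exists_step default a.1.1 (a.1.2 default)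
  have hyp : y ∈ pInfty (colorLanguage J) I M := fun i hi =>
    a.1.2 i ((hM.step_pred i _ _ _ hy).2.2 hi)
  refine ha ⟨⟨y, hyp⟩, ?_⟩ trivial ⟨t, hy⟩
  exact ((unaryType_pInfty_eq_iff ⟨y, hyp⟩ a.1).2 fun j => (hM.step_color j _ _ _ hy).symm).trans
    a.2

theorem ColorAxioms.completeTheory_pInfty_eq {N : Type w}
    [(combLanguage (colorLanguage J) I).Structure N] (hM : ColorAxioms J I M)
    (hN : ColorAxioms J I N) (hc : inftyColors J I M = inftyColors J I N)
    (he : HasColorless J I M ↔ HasColorless J I N) :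
    (combLanguage (colorLanguage J) I).completeTheory (pInfty (colorLanguage J) I M) =
      (combLanguage (colorLanguage J) I).completeTheory (pInfty (colorLanguage J) I N) :=
  completeTheory_eq_of_unary hM.not_relMap_pInfty hN.not_relMap_pInfty hM.infinite_unaryType
    hN.infinite_unaryType ((hM.range_unaryType_subset hN hc.le he.1).antisymm
      (hN.range_unaryType_subset hM hc.ge he.2))

end PInfty

/-! ### Unions of blocks -/

section BlockModel

variable {J B I : Type u} [LE J]

/-- The points of a disjoint union of blocks: the block `x` has infinitely many points of each
color `j ≥ b x`. -/
def BlockPoint (b : B → WithTop J) : Type u :=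
  {p : B × J × ℕ // b p.1 ≤ (p.2.1 : WithTop J)}

/-- The color language on a union of blocks with one additional point `none`, which serves as a
parameter of the two ternary relations. -/
def colorRel (b : B → WithTop J) :
    ∀ {n : ℕ}, (colorLanguage J).Relations n → (Fin n → Option (BlockPoint b)) → Prop
  | _, .color j, x => ∃ p, x 0 = some p ∧ p.1.2.1 = j
  | _, .block, x => x 2 = none ∧ ∃ p q, x 0 = some p ∧ x 1 = some q ∧ p.1.1 = q.1.1
  | _, .step, x => x 2 = none ∧ ∃ p q, x 0 = some p ∧ x 1 = some q ∧ p.1.1 = q.1.1 ∧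
      p.1.2.1 = q.1.2.1 ∧ p.1.2.2 < q.1.2.2

/-- The additional point together with the blocks labelled `i`. -/
def labelSet (b : B → WithTop J) (lab : B → Option I) (i : I) : Set (Option (BlockPoint b)) :=
  {a | ∀ p, a = some p → lab p.1.1 = some i}

/-- Interpretation of the color language on a union of blocks. -/
@[reducible] def colorStructure (b : B → WithTop J) :
    (colorLanguage J).Structure (Option (BlockPoint b)) where
  RelMap r x := colorRel b r x

/-- Interpretation of the predicates `P_i` by labels. -/
@[reducible] def labelStructure (b : B → WithTop J) (lab : B → Option I) :
    (predLanguage I).Structure (Option (BlockPoint b)) where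
  RelMap := fun r => match r with
    | PredSymbol.pred i => fun x => x 0 ∈ labelSet b lab i

/-- The union of blocks as a structure of the language of a `P`-combination. -/
@[reducible] def blockStructure (b : B → WithTop J) (lab : B → Option I) :
    (combLanguage (colorLanguage J) I).Structure (Option (BlockPoint b)) :=
  @sumStructure (colorLanguage J) (predLanguage I) _ (colorStructure b) (labelStructure b lab)

theorem blockStructure_colorAxioms (b : B → WithTop J) (lab : B → Option I)
    (hle : ∀ {x : WithTop J} {a c : J}, x ≤ a → a ≤ c → x ≤ c) :
    @ColorAxioms J I _ (Option (BlockPoint b)) (blockStructure b lab) := by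
  let _ := blockStructure b lab
  have hpred : ∀ (i : I) (x : Option (BlockPoint b)),
      Structure.RelMap (predSymbol (colorLanguage J) i) ![x] ↔
        ∀ p, x = some p → lab p.1.1 = some i := fun i x => Iff.rfl
  have hcol : ∀ (j : J) (x : Option (BlockPoint b)),
      Structure.RelMap (colorSymbol (I := I) j) ![x] ↔ ∃ p, x = some p ∧ p.1.2.1 = j :=
    fun i x => Iff.rfl
  have hblock : ∀ x y z : Option (BlockPoint b),
      Structure.RelMap (blockSymbol (J := J) (I := I)) ![x, y, z] ↔
        z = none ∧ ∃ p q, x = some p ∧ y = some q ∧ p.1.1 = q.1.1 := fun x y z => Iff.rfl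
  have hstep : ∀ x y z : Option (BlockPoint b),
      Structure.RelMap (stepSymbol (J := J) (I := I)) ![x, y, z] ↔
        z = none ∧ ∃ p q, x = some p ∧ y = some q ∧ p.1.1 = q.1.1 ∧
          p.1.2.1 = q.1.2.1 ∧ p.1.2.2 < q.1.2.2 := fun x y z => Iff.rfl
  constructor
  · intro i x y z h
    obtain ⟨rfl, p, q, rfl, rfl, hpq⟩ := (hblock x y z).1 h
    simp [hpred, hpq]
  · intro i x y z h
    obtain ⟨rfl, p, q, rfl, rfl, hpq, -⟩ := (hstep x y z).1 h
    simp [hpred, hpq]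
  · intro x y z t t' h h'
    obtain ⟨rfl, p, q, rfl, rfl, h₁, h₂, h₃⟩ := (hstep _ _ _).1 h
    obtain ⟨rfl, q', r, hq, rfl, h₁', h₂', h₃'⟩ := (hstep _ _ _).1 h'
    obtain rfl := Option.some_injective _ hq
    exact (hstep _ _ _).2 ⟨rfl, p, r, rfl, rfl, h₁.trans h₁', h₂.trans h₂', h₃.trans h₃'⟩
  · intro x t h
    obtain ⟨rfl, p, q, rfl, hq, -, -, h⟩ := (hstep _ _ _).1 h
    obtain rfl := Option.some_injective _ hq
    exact h.false
  · intro a c hac x h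
    obtain ⟨p, rfl, rfl⟩ := (hcol _ _).1 h
    exact ⟨some ⟨(p.1.1, c, 0), hle p.2 hac⟩, none, (hblock _ _ _).2 ⟨rfl, _, _, rfl, rfl, rfl⟩,
      (hcol _ _).2 ⟨_, rfl, rfl⟩⟩
  · intro i x h
    rw [hpred] at h
    push Not at h
    obtain ⟨p, rfl, -⟩ := h
    exact ⟨some ⟨(p.1.1, p.1.2.1, p.1.2.2 + 1), p.2⟩, none,
      (hstep _ _ _).2 ⟨rfl, _, _, rfl, rfl, rfl, rfl, Nat.lt_succ_self _⟩⟩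
  · intro j x y t h
    obtain ⟨rfl, p, q, rfl, rfl, -, h, -⟩ := (hstep _ _ _).1 h
    simp [hcol, h]
  · intro a c hac x h h'
    obtain ⟨p, rfl, rfl⟩ := (hcol _ _).1 h
    obtain ⟨q, hq, rfl⟩ := (hcol _ _).1 h'
    obtain rfl := Option.some_injective _ hq
    exact hac rfl
  · intro _ i x h
    rw [hpred] at h
    push Not at h
    obtain ⟨p, rfl, -⟩ := h
    exact ⟨p.1.2.1, (hcol _ _).2 ⟨p, rfl, rfl⟩⟩

/-- A bijection between blocks that respects least colors induces a bijection between points. -/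
def BlockPoint.congr {B' : Type u} {b : B → WithTop J} {b' : B' → WithTop J} (e : B ≃ B')
    (he : ∀ x, b' (e x) = b x) : BlockPoint b ≃ BlockPoint b' :=
  (e.prodCongr (Equiv.refl (J × ℕ))).subtypeEquiv fun p => by simp [he]

theorem colorRel_congr {B' : Type u} {b : B → WithTop J} {b' : B' → WithTop J} (e : B ≃ B')
    (he : ∀ x, b' (e x) = b x) {n : ℕ} (r : (colorLanguage J).Relations n)
    (x : Fin n → Option (BlockPoint b)) :
    colorRel b r x ↔ colorRel b' r ((BlockPoint.congr e he).optionCongr ∘ x) := by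
  have h₁ : ∀ p : BlockPoint b, (BlockPoint.congr e he p).1.1 = e p.1.1 := fun p => rfl
  have h₂ : ∀ p : BlockPoint b, (BlockPoint.congr e he p).1.2 = p.1.2 := fun p => rfl
  cases r with
  | color j =>
    simp only [colorRel, Function.comp_apply]
    cases x 0 <;> simp [h₂]
  | block =>
    simp only [colorRel, Function.comp_apply]
    cases x 0 <;> cases x 1 <;> cases x 2 <;> simp [h₁]
  | step =>
    simp only [colorRel, Function.comp_apply]
    cases x 0 <;> cases x 1 <;> cases x 2 <;> simp [h₁, h₂]

theorem labelSet_congr {B' : Type u} {b : B → WithTop J} {b' : B' → WithTop J} (e : B ≃ B')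
    (he : ∀ x, b' (e x) = b x) {lab : B → Option I} {lab' : B' → Option I} {i : I}
    (hi : ∀ x, lab x = some i ↔ lab' (e x) = some i) (a : Option (BlockPoint b)) :
    a ∈ labelSet b lab i ↔ (BlockPoint.congr e he).optionCongr a ∈ labelSet b' lab' i := by
  have h₁ : ∀ p : BlockPoint b, (BlockPoint.congr e he p).1.1 = e p.1.1 := fun p => rfl
  cases a <;> simp [labelSet, h₁, hi]

/-- Reduces elementary equivalence to combinatorics of the index sets: a bijection of blocks that
preserves the bounds respects all color relations, and labels matter only finitely many at a time.
-/
theorem models_completeTheory_of_blocks {B' : Type u} (b : B → WithTop J) (b' : B' → WithTop J)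
    (lab : B → Option I) (lab' : B' → Option I)
    (h : ∀ s : Finset I, ∃ e : B ≃ B', (∀ x, b' (e x) = b x) ∧
      ∀ i ∈ s, ∀ x, lab x = some i ↔ lab' (e x) = some i) :
    @Theory.Model _ (Option (BlockPoint b')) (blockStructure b' lab')
      (@completeTheory _ (Option (BlockPoint b)) (blockStructure b lab)) := by
  let _ := blockStructure b lab
  let _ := blockStructure b' lab'
  refine realize_completeTheory_of_equiv fun s => ?_
  obtain ⟨e, he, hs⟩ := h s
  exact ⟨(BlockPoint.congr e he).optionCongr, fun l r x => colorRel_congr e he r x,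
    fun i hi x => labelSet_congr e he (hs i hi) (x 0)⟩

end BlockModel

/-! ### The family of blocks and the size of its language -/

section BlockFamily

theorem card_combLanguage_colorLanguage (J I : Type u) :
    (combLanguage (colorLanguage J) I).card = Cardinal.mk J + 2 + Cardinal.mk I := by
  have h₁ : (colorLanguage J).card = Cardinal.mk J + 2 := by
    have : (colorLanguage J).Symbols ≃ J ⊕ ULift.{u} Bool :=
      { toFun := fun s => match s with
          | Sum.inl f => isEmptyElim f.2
          | Sum.inr ⟨_, .color j⟩ => Sum.inl j
          | Sum.inr ⟨_, .block⟩ => Sum.inr ⟨true⟩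
          | Sum.inr ⟨_, .step⟩ => Sum.inr ⟨false⟩
        invFun := fun s => match s with
          | Sum.inl j => Sum.inr ⟨1, .color j⟩
          | Sum.inr ⟨true⟩ => Sum.inr ⟨3, .block⟩
          | Sum.inr ⟨false⟩ => Sum.inr ⟨3, .step⟩
        left_inv := by
          rintro (⟨n, f⟩ | ⟨n, r⟩)
          · exact isEmptyElim f
          · cases r <;> rfl
        right_inv := by rintro (j | ⟨_ | _⟩) <;> rfl }
    rw [Language.card, Cardinal.mk_congr this]
    simp
  have h₂ : (predLanguage I).card = Cardinal.mk I := by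
    have : (predLanguage I).Symbols ≃ I :=
      { toFun := fun s => match s with
          | Sum.inl f => isEmptyElim f.2
          | Sum.inr ⟨_, .pred i⟩ => i
        invFun := fun i => Sum.inr ⟨1, .pred i⟩
        left_inv := by
          rintro (⟨n, f⟩ | ⟨n, r⟩)
          · exact isEmptyElim f
          · cases r; rfl
        right_inv := fun i => rfl }
    rw [Language.card, Cardinal.mk_congr this]
  rw [combLanguage, card_sum, h₁, h₂]
  simp

theorem card_combLanguage_nat_prod_withTop (J : Type u) :
    (combLanguage (colorLanguage J) (ℕ × WithTop J)).card =
      max (Cardinal.mk J) Cardinal.aleph0 := by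
  have hJ : Cardinal.mk (WithTop J) = Cardinal.mk J + 1 := Cardinal.mk_option
  rw [card_combLanguage_colorLanguage]
  simp only [Cardinal.mk_prod, Cardinal.mk_nat, Cardinal.lift_aleph0, hJ,
    Cardinal.lift_uzero]
  rcases lt_or_ge (Cardinal.mk J) Cardinal.aleph0 with h | h
  · obtain ⟨n, hn⟩ := Cardinal.lt_aleph0.1 h
    rw [max_eq_right h.le, hn]
    have h2 : Cardinal.aleph0 * ((n : Cardinal.{u}) + 1) = Cardinal.aleph0 := by
      exact_mod_cast Cardinal.aleph0_mul_nat n.succ_ne_zero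
    have h3 : (n : Cardinal.{u}) + 2 + Cardinal.aleph0 = Cardinal.aleph0 := by
      exact_mod_cast Cardinal.nat_add_aleph0 (n + 2)
    rw [h2, h3]
  · have h2 : (2 : Cardinal.{u}) ≤ Cardinal.mk J :=
      (by exact_mod_cast (Cardinal.natCast_lt_aleph0 (n := 2)).le : (2 : Cardinal.{u}) ≤ _).trans h
    rw [max_eq_left h, Cardinal.add_one_eq h, Cardinal.aleph0_mul_eq h,
      Cardinal.add_eq_left h h2, Cardinal.add_eq_self h]

/-- Shifting the points `(n, a)` beyond all of `s` makes room for one more point. -/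
theorem exists_shift_equiv {K : Type u} (a : K) (s : Finset (ℕ × K)) :
    ∃ e : ℕ × K ≃ Option (ℕ × K), (∀ x, ((e x).elim a Prod.snd) = x.2) ∧
      ∀ i ∈ s, ∀ x, some x = some i ↔ e x = some i := by
  classical
  obtain ⟨N, hN⟩ : ∃ N, ∀ i ∈ s, i.1 < N :=
    ⟨s.sup Prod.fst + 1, fun i hi => Nat.lt_succ_of_le (Finset.le_sup (f := Prod.fst) hi)⟩
  refine ⟨{
    -- The point `(N, a)` goes to `none`, each `(n, a)` with `n > N` moves down by one, and
    -- everything else, including `s`, is fixed.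
    toFun := fun x => if x.2 = a ∧ N ≤ x.1 then
      (if x.1 = N then none else some (x.1 - 1, x.2)) else some x
    invFun := fun o => o.elim (N, a) fun x => if x.2 = a ∧ N ≤ x.1 then (x.1 + 1, x.2) else x
    left_inv := ?_
    right_inv := ?_ }, ?_, ?_⟩
  · rintro ⟨n, k⟩
    grind
  · rintro (_ | ⟨n, k⟩)
    · simp
    · grind
  · rintro ⟨n, k⟩
    simp only [Equiv.coe_fn_mk]
    grind
  · rintro ⟨m, l⟩ hi ⟨n, k⟩
    have := hN _ hi
    simp only [Equiv.coe_fn_mk]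
    grind

variable (J : Type u) [LE J]

/-- The blocks are indexed by `ℕ × WithTop J`; the second coordinate is a lower bound for the
colors in the block. Each structure of the family is one block with the additional point. -/
def blockFamily : PFamily (colorLanguage J) (ℕ × WithTop J)
    (Option (BlockPoint (Prod.snd : ℕ × WithTop J → WithTop J))) where
  P := labelSet Prod.snd some
  nonempty i := ⟨none, fun p hp => by simp at hp⟩
  cover a := by
    rcases a with - | p
    · exact ⟨(0, ⊤), fun p hp => by simp at hp⟩
    · exact ⟨p.1.1, fun q hq => by rw [Option.some_injective _ hq]⟩
  str i := { RelMap := fun r x => colorRel Prod.snd r fun k => (x k).1 }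

/-- Every related tuple consists of points of one block and possibly `none`, so it already lies in a
single member of the family. -/
theorem blockFamily_unionStructure :
    (blockFamily J).unionStructure = colorStructure Prod.snd := by
  have hkey : ∀ (n : ℕ) (r : (colorLanguage J).Relations n)
      (x : Fin n → Option (BlockPoint (Prod.snd : ℕ × WithTop J → WithTop J))),
      colorRel Prod.snd r x → ∃ i, ∀ k, x k ∈ (blockFamily J).P i := by
    intro n r x h
    have hsome : ∀ p : BlockPoint (Prod.snd : ℕ × WithTop J → WithTop J),
        some p ∈ (blockFamily J).P p.1.1 := fun p q hq => by rw [Option.some_injective _ hq]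
    have hnone : ∀ i, none ∈ (blockFamily J).P i := fun i p hp => by simp at hp
    cases r with
    | color j =>
      obtain ⟨p, hp, -⟩ := h
      refine ⟨p.1.1, fun k => ?_⟩
      rw [Subsingleton.elim k 0, hp]
      exact hsome p
    | block =>
      obtain ⟨h, p, q, hp, hq, hpq⟩ := h
      refine ⟨p.1.1, fun k => ?_⟩
      fin_cases k
      · exact hp ▸ hsome p
      · exact hq ▸ hpq ▸ hsome q
      · exact h ▸ hnone _
    | step =>
      obtain ⟨h, p, q, hp, hq, hpq, -⟩ := h
      refine ⟨p.1.1, fun k => ?_⟩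
      fin_cases k
      · exact hp ▸ hsome p
      · exact hq ▸ hpq ▸ hsome q
      · exact h ▸ hnone _
  refine Structure.ext ?_ ?_
  · funext n f
    exact isEmptyElim f
  · funext n r x
    refine propext ⟨?_, fun h => ?_⟩
    · rintro ⟨i, y, hy, h⟩
      obtain rfl := funext hy
      exact h
    · obtain ⟨i, hi⟩ := hkey n r x h
      exact ⟨i, fun k => ⟨x k, hi k⟩, fun _ => rfl, h⟩

theorem blockFamily_isPCombination : (blockFamily J).IsPCombination := by
  intro i n r x
  rw [blockFamily_unionStructure]
  exact Iff.rfl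

theorem blockFamily_combTheory : (blockFamily J).combTheory =
    @completeTheory _ _ (blockStructure Prod.snd (some : ℕ × WithTop J → _)) := by
  have : (blockFamily J).combStructure = blockStructure Prod.snd some := by
    rw [PFamily.combStructure, blockFamily_unionStructure]
    rfl
  rw [PFamily.combTheory, this]

end BlockFamily

/-! ### Computation of the `e`-spectrum -/

section Spectrum

/-- By well-foundedness a nonempty upward closed set is the final segment above its least element;
`⊤` encodes the empty set. -/
theorem exists_withTop_le_iff {J : Type u} [LinearOrder J] [WellFoundedLT J] (C : Set J)
    (hC : ∀ a b, a ≤ b → a ∈ C → b ∈ C) : ∃ a : WithTop J, ∀ j : J, j ∈ C ↔ a ≤ j := by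
  by_cases h : C.Nonempty
  · obtain ⟨m, hm, hmin⟩ := wellFounded_lt.has_min C h
    refine ⟨m, fun j => ?_⟩
    rw [WithTop.coe_le_coe]
    exact ⟨fun hj => not_lt.1 (hmin j hj), fun hj => hC m j hj hm⟩
  · rw [Set.not_nonempty_iff_eq_empty] at h
    exact ⟨⊤, fun j => by simp [h]⟩

variable (J : Type u) [LinearOrder J]

theorem colorAxioms_of_models_blockFamily (M : Type w)
    [(combLanguage (colorLanguage J) (ℕ × WithTop J)).Structure M]
    (hM : M ⊨ (blockFamily J).combTheory) : ColorAxioms J (ℕ × WithTop J) M := by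
  rw [blockFamily_combTheory] at hM
  let _ := blockStructure (Prod.snd : ℕ × WithTop J → _) some
  exact ColorAxioms.of_models hM (blockStructure_colorAxioms Prod.snd some
    fun h h' => h.trans (WithTop.coe_le_coe.2 h'))

/-- The model with one additional block, without label, of least color `a`. -/
theorem exists_model_inftyColors_eq (a : J) :
    ∃ M : Theory.ModelType.{u, u, u} (blockFamily J).combTheory,
      inftyColors J (ℕ × WithTop J) M = Set.Ici a := by
  let b : Option (ℕ × WithTop J) → WithTop J := fun o => o.elim a Prod.snd
  let _ := blockStructure b id
  have hmodel : Option (BlockPoint b) ⊨ (blockFamily J).combTheory := by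
    rw [blockFamily_combTheory]
    refine models_completeTheory_of_blocks Prod.snd b some id fun s => ?_
    -- The new block `none` has bound `a`, so the blocks `(n, a)` with large `n` are shifted to
    -- absorb it.
    exact exists_shift_equiv (a : WithTop J) s
  refine ⟨@Theory.ModelType.of _ _ (Option (BlockPoint b)) _ hmodel ⟨none⟩, ?_⟩
  have hinf : ∀ x : Option (BlockPoint b),
      x ∈ pInfty (colorLanguage J) (ℕ × WithTop J) (Option (BlockPoint b)) ↔
        ∃ p, x = some p ∧ p.1.1 = none := by
    intro x
    constructor
    · intro h
      rcases x with - | p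
      -- The shared point lies in every `P_i`, and `(0, ⊤)` is an index available even for empty
      -- `J`.
      · exact absurd (fun p hp => by simp at hp) (h (0, ⊤))
      · refine ⟨p, rfl, Option.eq_none_iff_forall_ne_some.2 fun i hi => h i ?_⟩
        intro q hq
        rwa [← Option.some_injective _ hq]
    · rintro ⟨p, rfl, hp⟩ i h
      have := h p rfl
      rw [hp] at this
      simp at this
  ext j
  constructor
  · rintro ⟨⟨x, hx⟩, q, hq, hj⟩
    obtain ⟨p, rfl, hp⟩ := (hinf x).1 hx
    obtain rfl : p = q := Option.some_injective _ hq
    have := p.2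
    rw [hp, hj] at this
    exact WithTop.coe_le_coe.1 this
  · intro hj
    exact ⟨⟨some ⟨(none, j, 0), WithTop.coe_le_coe.2 hj⟩, (hinf _).2 ⟨_, rfl, rfl⟩⟩, _, rfl, rfl⟩

theorem mk_le_eSp : Cardinal.mk J ≤ eSp (blockFamily J).combTheory := by
  choose M hM using exists_model_inftyColors_eq J
  have hne : ∀ a, Nonempty (pInfty (colorLanguage J) (ℕ × WithTop J) (M a)) := fun a => by
    have ha : a ∈ inftyColors J (ℕ × WithTop J) (M a) := by
      rw [hM]
      exact Set.self_mem_Ici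
    exact ⟨ha.choose⟩
  refine Cardinal.mk_le_of_injective (f := fun a => ⟨_, M a, hne a, rfl⟩) fun a a' h => ?_
  have h' := congrArg Subtype.val h
  dsimp only at h'
  have hc : inftyColors J (ℕ × WithTop J) (M a) = inftyColors J (ℕ × WithTop J) (M a') := by
    ext j
    rw [mem_inftyColors_iff, mem_inftyColors_iff, h']
  rw [hM, hM] at hc
  exact Set.Ici_injective hc

theorem eSp_le_mk [WellFoundedLT J] : eSp (blockFamily J).combTheory ≤ Cardinal.mk J := by
  have hax : ∀ M : Theory.ModelType.{u, u, u} (blockFamily J).combTheory,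
      ColorAxioms J (ℕ × WithTop J) M := fun M =>
    colorAxioms_of_models_blockFamily J M M.is_model
  have hbound : ∀ M : Theory.ModelType.{u, u, u} (blockFamily J).combTheory,
      ∃ a : WithTop J, ∀ j : J, j ∈ inftyColors J (ℕ × WithTop J) M ↔ a ≤ j := fun M =>
    exists_withTop_le_iff _ fun _ _ h h' => (hax M).inftyColors_upward h h'
  choose a ha using hbound
  unfold eSp
  have hM := fun Θ : {Θ : (combLanguage (colorLanguage J) (ℕ × WithTop J)).Theory |
    ∃ M : Theory.ModelType.{u, u, u} (blockFamily J).combTheory,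
      Nonempty (pInfty (colorLanguage J) (ℕ × WithTop J) M) ∧
        (combLanguage (colorLanguage J) (ℕ × WithTop J)).completeTheory
          (pInfty (colorLanguage J) (ℕ × WithTop J) M) = Θ} => Θ.2
  choose M hne hM using hM
  have hinj : ∀ Θ Θ', a (M Θ) = a (M Θ') →
      (HasColorless J (ℕ × WithTop J) (M Θ) ↔ HasColorless J (ℕ × WithTop J) (M Θ')) →
      Θ = Θ' := by
    intro Θ Θ' h h'
    refine Subtype.ext ?_
    rw [← hM Θ, ← hM Θ']
    refine (hax _).completeTheory_pInfty_eq (hax _) ?_ h'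
    ext j
    rw [ha, ha, h]
  rcases finite_or_infinite J with hJ | hJ
  · have hcol : ∀ Θ, ∀ x : pInfty (colorLanguage J) (ℕ × WithTop J) (M Θ), ∃ j : J,
        Structure.RelMap (colorSymbol (I := ℕ × WithTop J) j) ![x.1] := fun Θ x =>
      (hax (M Θ)).exists_color hJ (0, ⊤) x.1 (x.2 _)
    -- For finite `J` the count must be exact: the restriction is nonempty and all its points are
    -- colored, so the bound `⊤` is excluded.
    have htop : ∀ Θ, ∃ c : J, a (M Θ) = c := by
      intro Θ
      obtain ⟨x⟩ := hne Θ
      obtain ⟨j, hj⟩ := hcol Θ x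
      have := (ha (M Θ) j).1 ⟨x, hj⟩
      exact ⟨(a (M Θ)).untop (ne_top_of_le_ne_top WithTop.coe_ne_top this),
        (WithTop.coe_untop _ _).symm⟩
    have hno : ∀ Θ, ¬ HasColorless J (ℕ × WithTop J) (M Θ) := fun Θ ⟨x, hx⟩ => by
      obtain ⟨j, hj⟩ := hcol Θ x
      exact hx j hj
    choose c hc using htop
    refine Cardinal.mk_le_of_injective (f := c) fun Θ Θ' h => hinj Θ Θ' ?_ ?_
    · rw [hc, hc, h]
    · exact iff_of_false (hno _) (hno _)
  · have h : Cardinal.aleph0 ≤ Cardinal.mk J := Cardinal.aleph0_le_mk J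
    -- For infinite `J` the extra value `⊤` and the factor 2 for colorless points are absorbed.
    have hcard : Cardinal.mk (WithTop J × ULift.{u} Prop) = Cardinal.mk J := by
      have h₁ : Cardinal.mk (WithTop J) = Cardinal.mk J + 1 := Cardinal.mk_option
      rw [Cardinal.mk_prod, Cardinal.lift_id, Cardinal.lift_id, h₁, Cardinal.add_one_eq h,
        Cardinal.mk_uLift, Cardinal.mk_Prop]
      refine Cardinal.mul_eq_left h ?_ (by simp)
      exact (by simp :
        Cardinal.lift.{u} (2 : Cardinal.{0}) ≤ Cardinal.aleph0).trans h
    rw [← hcard]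
    refine Cardinal.mk_le_of_injective
      (f := fun Θ => (a (M Θ), ⟨HasColorless J (ℕ × WithTop J) (M Θ)⟩)) fun Θ Θ' h => ?_
    exact hinj Θ Θ' (congrArg Prod.fst h) (iff_of_eq (congrArg (fun x => x.2.down) h))

end Spectrum

theorem proposition4p12 (lam : Cardinal.{u}) :
    ∃ (L₀ : FirstOrder.Language.{u, u}) (_ : L₀.IsRelational) (I : Type u) (_ : Nonempty I)
      (A : Type u) (F : PFamily L₀ I A),
      F.IsPCombination ∧
      (combLanguage L₀ I).card = max lam Cardinal.aleph0.{u} ∧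
      eSp F.combTheory = lam := by
  induction lam using Cardinal.inductionOn with | _ J
  -- Any well-order on `J` will do, since only its cardinality is prescribed.
  obtain ⟨_, _⟩ := exists_wellFoundedLT J
  exact ⟨colorLanguage J, inferInstance, ℕ × WithTop J, ⟨(0, ⊤)⟩, _, blockFamily J,
    blockFamily_isPCombination J, card_combLanguage_nat_prod_withTop J,
    (eSp_le_mk J).antisymm (mk_le_eSp J)⟩
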